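/- Let $g$ be the $2$-uniform morphism $0\to 01,\ 1\to 20,\ 2\to 23,\ 3\to 02$, let $\tau$ be the coding $0\to 2,\ 1\to 1,\ 2\to 0,\ 3\to 1$, and let $\mathbf{vtm}=\tau(g^\omega(0))=2102012101202102012\cdots$ be Thue's squarefree word over $\{0,1,2\}$. Let $\eta$ be the morphism $0\to 00011101$, $1\to 001110001101$, $2\to 0011000111001101$. A square is a nonempty word of the form $xx$. An infinite word is $k$-automatic if it is the image, under a coding (a letter-to-letter map), of a fixed point $h^\omega(a)$ of a $k$-uniform morphism $h$ over a finite alphabet $\Sigma$; the weight of $h$ is $\sum_{b\in\Sigma}|h(b)|$. A $k$-automaton with output generates an infinite word $w_0w_1w_2\cdots$ if, for every $n\ge 0$, on reading any base-$k$ representation of $n$ (most significant digit first, leading zeros allowed), it outputs $w_n$. Then the infinite binary word $\eta(\mathbf{vtm})$ has exactly three distinct squares as factors: $0^2$, $1^2$ and $(10)^2$. It is $2$-automatic; it is generated by a $2$-automaton with $27$ states and by none with fewer; and its weight, i.e., the least weight of a $2$-uniform morphism having a fixed point of which $\eta(\mathbf{vtm})$ is the image under a coding, is $2\cdot 27=54$.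 -/

import Mathlib

namespace Words

/-- The morphism of free monoids determined by the images `h a` of the letters,
applied to a finite word. -/
def apply {α β : Type} (h : α → List β) (l : List α) : List β :=
  l.flatMap h

/-- `h` is `k`-uniform: all images of letters have length `k`. -/
def IsUniform {α β : Type} (k : ℕ) (h : α → List β) : Prop :=
  ∀ a, (h a).length = k

/-- The weight of a morphism: the sum of the lengths of the images of the letters. -/
def weight {α β : Type} [Fintype α] (h : α → List β) : ℕ :=
  ∑ a, (h a).length

/-- `h a = a x` where no iterate `h ^ i` sends `x` to the empty word; this is the condition under
which iterating `h` on `a` produces an infinite word. -/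
def IsProlongable {α : Type} (h : α → List α) (a : α) : Prop :=
  ∃ x : List α, h a = a :: x ∧ ∀ i : ℕ, (apply h)^[i] x ≠ []

/-- The infinite word `h ^ ω (a)`. For `h` prolongable on `a`, each `h ^ n (a)` is a prefix of
`h ^ (n + 1) (a)` and has more than `n` letters, so the letter at position `n` is read off
`h ^ n (a)` (the fallback value of `getD` is not used). -/
def omega {α : Type} (h : α → List α) (a : α) : ℕ → α :=
  fun n => ((apply h)^[n] [a]).getD n a

/-- The image `h (w)` of an infinite word `w`. If no letter is sent to the empty word, then
`h (w 0 ⋯ w n)` has more than `n` letters, so the letter at position `n` is read off it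
(the fallback value of `getD` is not used). -/
def image {α β : Type} [Inhabited β] (h : α → List β) (w : ℕ → α) : ℕ → β :=
  fun n => (apply h ((List.range (n + 1)).map w)).getD n default

/-- The factor (contiguous subword) `w i, w (i + 1), …, w (i + n - 1)`. -/
def factor {α : Type} (w : ℕ → α) (i n : ℕ) : List α :=
  (List.range n).map fun j => w (i + j)

/-- The set of squares (nonempty words of the form `x x`) that occur in `w` as factors. -/
def squares {α : Type} (w : ℕ → α) : Set (List α) :=
  {u | (∃ x : List α, x ≠ [] ∧ u = x ++ x) ∧ ∃ i n : ℕ, u = factor w i n}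

/-- `w` is the image, under the coding `c`, of the fixed point `h ^ ω (a)` of the `k`-uniform
morphism `h`. -/
def IsGeneratedBy {α β : Type} (k : ℕ) (h : α → List α) (a : α) (c : α → β) (w : ℕ → β) : Prop :=
  IsUniform k h ∧ IsProlongable h a ∧ ∀ n, w n = c (omega h a n)

/-- `w` is `k`-automatic: it is the image, under a coding, of a fixed point of a `k`-uniform
morphism over a finite alphabet. -/
def IsAutomatic {β : Type} (k : ℕ) (w : ℕ → β) : Prop :=
  ∃ (s : ℕ) (h : Fin s → List (Fin s)) (a : Fin s) (c : Fin s → β), IsGeneratedBy k h a c w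

/-- The weights of all `k`-uniform morphisms that generate `w` up to a coding. -/
def generatorWeights {β : Type} (k : ℕ) (w : ℕ → β) : Set ℕ :=
  {m | ∃ (s : ℕ) (h : Fin s → List (Fin s)) (a : Fin s) (c : Fin s → β),
    IsGeneratedBy k h a c w ∧ m = weight h}

/-- A deterministic finite automaton with `s` states and output in `β`, reading base-`k` digits. -/
structure DFAO (k s : ℕ) (β : Type) where
  /-- The initial state. -/
  start : Fin s
  /-- The transition function. -/
  step : Fin s → Fin k → Fin s
  /-- The output attached to a state. -/
  out : Fin s → β

/-- The number with base-`k` representation `d`, most significant digit first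
(leading zeros allowed). -/
def value {k : ℕ} (d : List (Fin k)) : ℕ :=
  d.foldl (fun n b => k * n + (b : ℕ)) 0

/-- The automaton generates `w`: on each base-`k` representation of `n`, read with the most
significant digit first, its output is `w n`. -/
def DFAO.Generates {k s : ℕ} {β : Type} (M : DFAO k s β) (w : ℕ → β) : Prop :=
  ∀ d : List (Fin k), M.out (d.foldl M.step M.start) = w (value d)

/-- The numbers of states of the `k`-automata that generate `w`. -/
def stateCounts {β : Type} (k : ℕ) (w : ℕ → β) : Set ℕ :=
  {s | ∃ M : DFAO k s β, M.Generates w}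

/-- The morphism `0 → 01, 1 → 20, 2 → 23, 3 → 02`. -/
def g : Fin 4 → List (Fin 4) :=
  ![[0, 1], [2, 0], [2, 3], [0, 2]]

/-- The coding `0 → 2, 1 → 1, 2 → 0, 3 → 1`. -/
def tau : Fin 4 → Fin 3 :=
  ![2, 1, 0, 1]

/-- Thue's squarefree word `τ (g ^ ω (0)) = 2102012101202102012021012102012⋯`. -/
def vtm : ℕ → Fin 3 :=
  fun n => tau (omega g 0 n)

/-- The morphism `0 → 00011101, 1 → 001110001101, 2 → 0011000111001101`. -/
def eta : Fin 3 → List (Fin 2) :=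
  ![[0, 0, 0, 1, 1, 1, 0, 1],
    [0, 0, 1, 1, 1, 0, 0, 0, 1, 1, 0, 1],
    [0, 0, 1, 1, 0, 0, 0, 1, 1, 1, 0, 0, 1, 1, 0, 1]]

end Words

namespace Words

/-! ### Uniform morphisms, automata and minimality -/

section Uniform

variable {α β : Type} {k : ℕ}

/-! The images under `eta` have lengths 8, 12, 16, but `eta ∘ tau` is conjugate to the 12-uniform
`block`: the excess `carry` passed between letters is governed by a Thue–Morse bit
(`carry_append_eta`). So `etaWord` is the `block` image of `gWord`, and (letter, position mod 12)
gives 48 states, which merge into the 27 of `h27`. These are reachable and pairwise distinguishable,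
hence minimal; a 2-uniform generator on `s` letters is an automaton with `s` states and has weight
`2 * s`.

Squares of period below 19 are checked in the images of four letters. For longer ones, factors of
length 19 fix the position mod 12, so the period is `12 * q`; the square then descends to an overlap
of period `q` in the Thue–Morse word, which has none. -/

theorem IsUniform.length_apply {h : α → List β} (hu : IsUniform k h) (l : List α) :
    (apply h l).length = k * l.length := by
  induction l with
  | nil => simp [apply]
  | cons a l ih =>
    simp only [apply, List.flatMap_cons, List.length_append, List.length_cons] at ih ⊢
    rw [ih, hu a]; ring

theorem IsUniform.apply_getElem? {h : α → List β} (hu : IsUniform k h) (l : List α) (n b : ℕ)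
    (hb : b < k) : (apply h l)[k * n + b]? = l[n]?.bind fun a => (h a)[b]? := by
  induction l generalizing n with
  | nil => simp [apply]
  | cons a l ih =>
    simp only [apply, List.flatMap_cons] at ih ⊢
    cases n with
    | zero => simp [List.getElem?_append_left, hu a, hb]
    | succ n =>
      rw [List.getElem?_append_right (by rw [hu a, Nat.mul_succ]; omega), hu a,
        show k * (n + 1) + b - k = k * n + b by rw [Nat.mul_succ]; omega, ih]
      simp

theorem IsUniform.length_iterate {h : α → List α} (hu : IsUniform k h) (l : List α) (i : ℕ) :
    ((apply h)^[i] l).length = k ^ i * l.length := by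
  induction i with
  | zero => simp
  | succ i ih => rw [Function.iterate_succ_apply', hu.length_apply, ih, pow_succ]; ring

theorem apply_append (h : α → List β) (l m : List α) :
    apply h (l ++ m) = apply h l ++ apply h m := by
  simp [apply]

theorem apply_iterate_append (h : α → List α) (l m : List α) (i : ℕ) :
    (apply h)^[i] (l ++ m) = (apply h)^[i] l ++ (apply h)^[i] m := by
  induction i with
  | zero => rfl
  | succ i ih => simp only [Function.iterate_succ_apply', ih, apply_append]

theorem IsProlongable.iterate_prefix {h : α → List α} {a : α} (hp : IsProlongable h a)
    {m n : ℕ} (hmn : m ≤ n) : (apply h)^[m] [a] <+: (apply h)^[n] [a] := by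
  obtain ⟨x, hx, -⟩ := hp
  induction n, hmn using Nat.le_induction with
  | base => exact List.prefix_rfl
  | succ n _ ih =>
    refine ih.trans ⟨(apply h)^[n] x, ?_⟩
    rw [← apply_iterate_append, Function.iterate_succ_apply]
    simp [apply, hx]

theorem IsProlongable.iterate_getElem? {h : α → List α} {a : α} (hk : 2 ≤ k)
    (hu : IsUniform k h) (hp : IsProlongable h a) {m n : ℕ} (hn : n < k ^ m) :
    ((apply h)^[m] [a])[n]? = some (omega h a n) := by
  have hlt : n < k ^ n := Nat.lt_pow_self hk
  have key : ((apply h)^[m] [a])[n]? = ((apply h)^[n] [a])[n]? := by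
    rcases le_total m n with hmn | hmn
    · exact (List.prefix_iff_getElem?.1 (hp.iterate_prefix hmn) n
        (by rw [hu.length_iterate]; simpa)).symm ▸ (List.getElem?_eq_getElem _)
    · exact (List.prefix_iff_getElem?.1 (hp.iterate_prefix hmn) n
        (by rw [hu.length_iterate]; simpa)).trans (List.getElem?_eq_getElem _).symm
  rw [key, omega, List.getD_eq_getElem?_getD, List.getElem?_eq_getElem
    (by rw [hu.length_iterate]; simpa), Option.getD_some]

theorem omega_zero (h : α → List α) (a : α) : omega h a 0 = a := by
  simp [omega]

theorem IsProlongable.omega_mul_add {h : α → List α} {a : α} (hk : 2 ≤ k)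
    (hu : IsUniform k h) (hp : IsProlongable h a) (n : ℕ) {b : ℕ} (hb : b < k) :
    (h (omega h a n))[b]? = some (omega h a (k * n + b)) := by
  have h1 : n < k ^ n := Nat.lt_pow_self hk
  have h2 : k * n + b < k ^ (n + 1) := by rw [pow_succ]; nlinarith
  rw [← hp.iterate_getElem? hk hu h2, Function.iterate_succ_apply',
    hu.apply_getElem? _ _ _ hb, hp.iterate_getElem? hk hu h1]
  rfl

/-- The automaton whose transitions are given by a uniform morphism. -/
def IsUniform.toDFAO {s : ℕ} {h : Fin s → List (Fin s)} (hu : IsUniform k h) (a : Fin s)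
    (c : Fin s → β) : DFAO k s β where
  start := a
  step x b := (h x)[(b : ℕ)]'((hu x).symm ▸ b.2)
  out := c

theorem IsUniform.foldl_toDFAO {s : ℕ} {h : Fin s → List (Fin s)} {a : Fin s} (hk : 2 ≤ k)
    (hu : IsUniform k h) (hp : IsProlongable h a) (c : Fin s → β) (d : List (Fin k)) :
    d.foldl (hu.toDFAO a c).step (hu.toDFAO a c).start = omega h a (value d) := by
  induction d using List.reverseRecOn with
  | nil => simp [value, toDFAO, omega_zero]
  | append_singleton d b ih =>
    have h1 := hp.omega_mul_add hk hu (value d) b.2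
    have h2 : value (d ++ [b]) = k * value d + b := by simp [value]
    rw [List.foldl_append, ih, h2]
    rw [List.getElem?_eq_getElem ((hu _).symm ▸ b.2), Option.some_inj] at h1
    exact h1

theorem IsGeneratedBy.generates {s : ℕ} {h : Fin s → List (Fin s)} {a : Fin s} {c : Fin s → β}
    {w : ℕ → β} (hk : 2 ≤ k) (hg : IsGeneratedBy k h a c w) :
    (hg.1.toDFAO a c).Generates w := by
  intro d
  rw [hg.1.foldl_toDFAO hk hg.2.1, hg.2.2]
  rfl

theorem IsUniform.weight_eq {s : ℕ} {h : Fin s → List β} (hu : IsUniform k h) :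
    weight h = k * s := by
  simp [weight, hu _, mul_comm]

/-- An automaton all of whose states are reachable and pairwise distinguishable is minimal. -/
theorem DFAO.Generates.card_le {s s' : ℕ} {w : ℕ → β} {M : DFAO k s β} {N : DFAO k s' β}
    (hM : M.Generates w) (hN : N.Generates w) (u : Fin s → List (Fin k))
    (hu : ∀ i, (u i).foldl M.step M.start = i)
    (hd : ∀ i j, (∀ v : List (Fin k), M.out (v.foldl M.step i) = M.out (v.foldl M.step j)) →
      i = j) : s ≤ s' := by
  -- Myhill–Nerode: access words that merge in `N` have the same outputs after every continuation.
  have hinj : Function.Injective fun i => (u i).foldl N.step N.start := by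
    intro i j hij
    refine hd i j fun v => ?_
    have hi := hM (u i ++ v)
    have hj := hM (u j ++ v)
    have hi' := hN (u i ++ v)
    have hj' := hN (u j ++ v)
    simp only [List.foldl_append, hu] at hi hj hi' hj' hij
    rw [hi, hj, ← hi', ← hj', hij]
  simpa using Fintype.card_le_of_injective _ hinj

end Uniform

/-! ### The fixed point of `g` and the Thue–Morse word -/

section ThueMorse

theorem g_uniform : IsUniform 2 g := by unfold IsUniform; decide

theorem IsUniform.isProlongable {α : Type} {k : ℕ} (hk : 2 ≤ k) {h : α → List α}
    (hu : IsUniform k h) {a : α} {x : List α} (hx : h a = a :: x) : IsProlongable h a := by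
  refine ⟨x, hx, fun i hi => ?_⟩
  have h1 := hu.length_iterate x i
  have h2 := hu a
  rw [hx, List.length_cons] at h2
  rw [hi, List.length_nil] at h1
  have : 0 < k ^ i * x.length := Nat.mul_pos (Nat.pow_pos (by omega)) (by omega)
  omega

/-- The fixed point of `g`. -/
def gWord : ℕ → Fin 4 := omega g 0

/-- The two letters of the image under `g`. -/
def gStep : Fin 4 → Fin 2 → Fin 4 := ![![0, 1], ![2, 0], ![2, 3], ![0, 2]]

theorem gWord_two_mul_add (n : ℕ) (b : Fin 2) : gWord (2 * n + b) = gStep (gWord n) b := by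
  have h1 := (g_uniform.isProlongable (a := 0) le_rfl rfl).omega_mul_add le_rfl g_uniform n b.2
  have h2 : ∀ (a : Fin 4) (b : Fin 2), (g a)[(b : ℕ)]? = some (gStep a b) := by decide
  rw [h2, Option.some_inj] at h1
  exact h1.symm

theorem gWord_even (n : ℕ) : gWord (2 * n) = gStep (gWord n) 0 := gWord_two_mul_add n 0

theorem gWord_odd (n : ℕ) : gWord (2 * n + 1) = gStep (gWord n) 1 := gWord_two_mul_add n 1

/-- The letter of `gWord` at position `n` encodes the letters of the Thue–Morse word at
positions `n` and `n + 1`; this is the first one. -/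
def fstBit : Fin 4 → Bool := ![false, true, true, false]

/-- The second of the two Thue–Morse letters encoded by a letter of `gWord`. -/
def sndBit : Fin 4 → Bool := ![true, true, false, false]

/-- The factors of length two of `gWord`. -/
def Adj (a b : Fin 4) : Prop :=
  (a, b) ∈ [((0 : Fin 4), (1 : Fin 4)), (0, 2), (1, 2), (2, 0), (2, 3), (3, 0)]

instance : DecidableRel Adj := fun a b => by unfold Adj; infer_instance

theorem adj_gWord (n : ℕ) : Adj (gWord n) (gWord (n + 1)) := by
  induction n using Nat.strong_induction_on with
  | _ n ih =>
    have h1 : ∀ a, Adj (gStep a 0) (gStep a 1) := by decide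
    have h2 : ∀ a b, Adj a b → Adj (gStep a 1) (gStep b 0) := by decide
    rcases Nat.even_or_odd' n with ⟨m, rfl | rfl⟩
    · rw [gWord_even, gWord_odd]; exact h1 _
    · rw [gWord_odd, show 2 * m + 1 + 1 = 2 * (m + 1) by ring, gWord_even]
      exact h2 _ _ (ih m (by omega))

/-- The Thue–Morse word. -/
def thueMorse (n : ℕ) : Bool := fstBit (gWord n)

theorem thueMorse_succ (n : ℕ) : thueMorse (n + 1) = sndBit (gWord n) := by
  have h : ∀ a b, Adj a b → fstBit b = sndBit a := by decide
  exact h _ _ (adj_gWord n)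

theorem thueMorse_even (n : ℕ) : thueMorse (2 * n) = thueMorse n := by
  have h : ∀ a, fstBit (gStep a 0) = fstBit a := by decide
  rw [thueMorse, gWord_even, h, thueMorse]

theorem thueMorse_odd (n : ℕ) : thueMorse (2 * n + 1) = !thueMorse n := by
  have h : ∀ a, fstBit (gStep a 1) = !fstBit a := by decide
  rw [thueMorse, gWord_odd, h, thueMorse]

theorem thueMorse_succ_of_even {n : ℕ} (hn : Even n) : thueMorse (n + 1) = !thueMorse n := by
  obtain ⟨m, rfl⟩ := even_iff_exists_two_mul.1 hn
  rw [thueMorse_odd, thueMorse_even]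

/-- The Thue–Morse word is overlap-free. -/
theorem thueMorse_overlapFree (q i : ℕ) (hq : 0 < q) :
    ¬ ∀ j ≤ q, thueMorse (i + j) = thueMorse (i + j + q) := by
  induction q using Nat.strong_induction_on generalizing i with
  | _ q ih =>
    intro h
    rcases Nat.even_or_odd' q with ⟨r, rfl | rfl⟩
    -- An even period halves, on reading every second letter.
    · refine ih r (by omega) (i / 2) (by omega) fun j hj => ?_
      rcases Nat.even_or_odd' i with ⟨m, rfl | rfl⟩
      · have := h (2 * j) (by omega)
        rw [show 2 * m + 2 * j = 2 * (m + j) by ring,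
          show 2 * (m + j) + 2 * r = 2 * (m + j + r) by ring, thueMorse_even, thueMorse_even] at this
        rwa [show 2 * m / 2 = m by omega]
      · have := h (2 * j) (by omega)
        rw [show 2 * m + 1 + 2 * j = 2 * (m + j) + 1 by ring,
          show 2 * (m + j) + 1 + 2 * r = 2 * (m + j + r) + 1 by ring, thueMorse_odd,
          thueMorse_odd, Bool.not_inj_iff] at this
        rwa [show (2 * m + 1) / 2 = m by omega]
    -- Neighbours starting at an even position differ. An odd period carries odd positions to even
    -- ones, so the letters alternate throughout, which an odd period forbids.
    · have halt : ∀ j < 2 * r + 1, thueMorse (i + (j + 1)) = !thueMorse (i + j) := by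
        intro j hj
        rcases Nat.even_or_odd (i + j) with he | ho
        · exact thueMorse_succ_of_even he
        · rw [h j hj.le, h (j + 1) hj, show i + (j + 1) + (2 * r + 1) = i + j + (2 * r + 1) + 1 by ring]
          exact thueMorse_succ_of_even (ho.add_odd ⟨r, rfl⟩)
      have hpar : ∀ m ≤ r, thueMorse (i + 2 * m) = thueMorse i := by
        intro m hm
        induction m with
        | zero => rfl
        | succ m ihm =>
          rw [show 2 * (m + 1) = 2 * m + 1 + 1 by ring, halt _ (by omega), halt _ (by omega),
            Bool.not_not, ihm (by omega)]
      have h0 := h 0 (by omega)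
      rw [Nat.add_zero, halt _ (by omega), hpar r le_rfl] at h0
      simp at h0

end ThueMorse

/-! ### Conjugation to a 12-uniform morphism -/

section Blocks

/-- The 12-uniform morphism mapping `gWord` to `image eta vtm`. -/
def block : Fin 4 → List (Fin 2) :=
  ![[0, 0, 1, 1, 0, 0, 0, 1, 1, 1, 0, 0],
    [1, 1, 0, 1, 0, 0, 1, 1, 1, 0, 0, 0],
    [1, 1, 0, 1, 0, 0, 0, 1, 1, 1, 0, 1],
    [0, 0, 1, 1, 1, 0, 0, 0, 1, 1, 0, 1]]

theorem block_uniform : IsUniform 12 block := by unfold IsUniform; decide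

/-- The words by which `eta ∘ tau` and `block` are conjugate. -/
def carry (b : Bool) : List (Fin 2) := if b then [1, 1, 0, 1] else []

theorem carry_append_eta : ∀ a, carry (fstBit a) ++ eta (tau a) = block a ++ carry (sndBit a) := by
  decide

theorem apply_eta_vtm (n : ℕ) : apply eta ((List.range n).map vtm) =
    apply block ((List.range n).map gWord) ++ carry (thueMorse n) := by
  induction n with
  | zero => simp [apply, carry, thueMorse, gWord, omega_zero, fstBit]
  | succ n ih =>
    rw [List.range_succ, List.map_append, List.map_append, apply_append, apply_append, ih,
      List.append_assoc, List.append_assoc, thueMorse_succ]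
    simpa [apply, vtm, thueMorse, gWord] using carry_append_eta (gWord n)

/-- The binary word `image eta vtm`. -/
def etaWord : ℕ → Fin 2 := image eta vtm

/-- The letter at position `r` of `block a`. -/
def blockLetter (a : Fin 4) (r : ℕ) : Fin 2 := (block a).getD r 0

theorem etaWord_eq (n : ℕ) {r : ℕ} (hr : r < 12) :
    etaWord (12 * n + r) = blockLetter (gWord n) r := by
  -- The prefix taken by `image` is long enough for the position to fall before the final `carry`.
  rw [etaWord, image, apply_eta_vtm, List.getD_append _ _ _ _
    (by rw [block_uniform.length_apply]; simp; omega), List.getD_eq_getElem?_getD,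
    block_uniform.apply_getElem? _ _ _ hr, List.getElem?_map,
    List.getElem?_range (by omega), blockLetter, List.getD_eq_getElem?_getD]
  rfl

end Blocks

/-! ### The minimal automaton and the weight -/

section Automaton

/-- The morphism on 27 letters whose fixed point is coded to `etaWord`. -/
def h27 : Fin 27 → List (Fin 27) :=
  ![[0, 1], [2, 3], [4, 5], [6, 7], [8, 9], [10, 11], [12, 7], [13, 14], [15, 16], [17, 18],
    [2, 19], [4, 5], [12, 7], [15, 16], [0, 18], [20, 21], [22, 23], [0, 1], [2, 3], [6, 7],
    [24, 5], [6, 25], [8, 14], [15, 26], [8, 9], [13, 14], [22, 23]]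

/-- The coding of the fixed point of `h27` to `etaWord`. -/
def c27 : Fin 27 → Fin 2 :=
  ![0, 0, 1, 1, 0, 0, 0, 1, 1, 1, 0, 0, 1, 0, 1, 0, 0, 1, 1, 0, 1, 1, 0, 1, 1, 0, 1]

/-- The state of the automaton at position `r` of the block of a letter. -/
def state27 : Fin 4 → Fin 12 → Fin 27 :=
  ![![0, 1, 2, 3, 4, 5, 6, 7, 8, 9, 10, 11], ![12, 7, 13, 14, 15, 16, 17, 18, 2, 19, 4, 5],
    ![12, 7, 13, 14, 15, 16, 0, 18, 20, 21, 22, 23], ![0, 1, 2, 3, 24, 5, 6, 25, 8, 14, 15, 26]]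

/-- A word leading from the initial state to the given one. -/
def access27 : Fin 27 → List (Fin 2) :=
  ![[], [1], [1, 0], [1, 1], [1, 0, 0], [1, 0, 1], [1, 1, 0], [1, 1, 1], [1, 0, 0, 0],
    [1, 0, 0, 1], [1, 0, 1, 0], [1, 0, 1, 1], [1, 1, 0, 0], [1, 1, 1, 0], [1, 1, 1, 1],
    [1, 0, 0, 0, 0], [1, 0, 0, 0, 1], [1, 0, 0, 1, 0], [1, 0, 0, 1, 1], [1, 0, 1, 0, 1],
    [1, 0, 0, 0, 0, 0], [1, 0, 0, 0, 0, 1], [1, 0, 0, 0, 1, 0], [1, 0, 0, 0, 1, 1],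
    [1, 0, 0, 0, 0, 0, 0], [1, 0, 0, 0, 0, 1, 1], [1, 0, 0, 0, 1, 1, 1]]

/-- Words distinguishing the states. -/
def tests27 : List (List (Fin 2)) :=
  [[], [0], [1], [0, 0], [0, 1], [1, 0], [1, 1], [0, 0, 0], [0, 0, 1], [0, 1, 0], [0, 1, 1],
    [1, 0, 0], [1, 0, 1], [1, 1, 0], [1, 1, 1]]

theorem h27_uniform : IsUniform 2 h27 := by unfold IsUniform; decide

theorem h27_isProlongable : IsProlongable h27 0 := h27_uniform.isProlongable le_rfl rfl

/-- Appending the digit `b` sends `12 * n + r` to `12 * (2 * n) + (2 * r + b)`; the quotient of `2 *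
r + b` by 12 is the digit fed to `gStep`, the remainder the new position. -/
theorem omega_h27 (m : ℕ) : omega h27 0 m = state27 (gWord (m / 12)) (Fin.ofNat 12 m) := by
  have hstep : ∀ (a : Fin 4) (r : Fin 12) (b : Fin 2), (h27 (state27 a r))[(b : ℕ)]? =
      some (state27 (gStep a (Fin.ofNat 2 ((2 * r + b) / 12))) (Fin.ofNat 12 (2 * r + b))) := by
    decide +kernel
  induction m using Nat.strong_induction_on with
  | _ m ih =>
    rcases Nat.eq_zero_or_pos m with rfl | hm
    · rw [omega_zero, gWord, omega_zero]; rfl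
    · have h1 := h27_isProlongable.omega_mul_add le_rfl h27_uniform (m / 2)
        (b := m % 2) (Nat.mod_lt _ two_pos)
      rw [ih (m / 2) (by omega), Nat.div_add_mod] at h1
      have h2 := hstep (gWord (m / 2 / 12)) (Fin.ofNat 12 (m / 2)) (Fin.ofNat 2 m)
      rw [Fin.val_ofNat, Fin.val_ofNat, h1, Option.some_inj, ← gWord_two_mul_add] at h2
      rw [h2, Fin.val_ofNat]
      congr 1
      · congr 1
        omega
      · ext
        simp only [Fin.val_ofNat]
        omega

theorem etaWord_eq_c27 (m : ℕ) : etaWord m = c27 (omega h27 0 m) := by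
  have h : ∀ (a : Fin 4) (r : Fin 12), c27 (state27 a r) = blockLetter a r := by decide
  rw [omega_h27, h, Fin.val_ofNat, ← etaWord_eq _ (Nat.mod_lt _ (by norm_num)), Nat.div_add_mod]

theorem isGeneratedBy_h27 : IsGeneratedBy 2 h27 0 c27 etaWord :=
  ⟨h27_uniform, h27_isProlongable, etaWord_eq_c27⟩

theorem isLeast_stateCounts_etaWord : IsLeast (stateCounts 2 etaWord) 27 := by
  have hgen := isGeneratedBy_h27.generates le_rfl
  refine ⟨⟨_, hgen⟩, ?_⟩
  rintro s ⟨N, hN⟩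
  refine hgen.card_le hN access27 ?_ ?_
  · decide +kernel
  · have h : ∀ i j : Fin 27, (∀ v ∈ tests27,
        c27 (v.foldl (h27_uniform.toDFAO 0 c27).step i) =
          c27 (v.foldl (h27_uniform.toDFAO 0 c27).step j)) → i = j := by
      decide +kernel
    exact fun i j hij => h i j fun v _ => hij v

theorem isLeast_generatorWeights_etaWord : IsLeast (generatorWeights 2 etaWord) 54 := by
  refine ⟨⟨27, h27, 0, c27, isGeneratedBy_h27, h27_uniform.weight_eq.symm⟩, ?_⟩
  rintro m ⟨s, h, a, c, hg, rfl⟩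
  have := isLeast_stateCounts_etaWord.2 ⟨_, hg.generates le_rfl⟩
  rw [hg.1.weight_eq]
  omega

end Automaton

/-! ### The squares -/

section Squares

theorem length_factor {α : Type} (w : ℕ → α) (i n : ℕ) : (factor w i n).length = n := by
  simp [factor]

theorem factor_add {α : Type} (w : ℕ → α) (i m n : ℕ) :
    factor w i (m + n) = factor w i m ++ factor w (i + m) n := by
  simp [factor, List.range_add, Function.comp_def, add_assoc]

theorem factor_eq_take_drop {α : Type} (w : ℕ → α) {i r m n : ℕ} (h : r + m ≤ n) :
    factor w (i + r) m = ((factor w i n).drop r).take m := by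
  obtain ⟨l, rfl⟩ := Nat.exists_eq_add_of_le h
  rw [add_assoc, factor_add, factor_add,
    List.drop_left' (length_factor _ _ _), List.take_left' (length_factor _ _ _)]

theorem factor_eq_factor_iff {α : Type} (w : ℕ → α) (i i' n : ℕ) :
    factor w i n = factor w i' n ↔ ∀ j < n, w (i + j) = w (i' + j) := by
  simp [factor]

theorem factor_etaWord_block (n : ℕ) : factor etaWord (12 * n) 12 = block (gWord n) := by
  have h : ∀ a, (List.range 12).map (blockLetter a) = block a := by decide
  rw [← h, factor]
  exact List.map_congr_left fun j hj => etaWord_eq n (List.mem_range.1 hj)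

theorem factor_etaWord_blocks (n : ℕ) : factor etaWord (12 * n) 48 =
    block (gWord n) ++ (block (gWord (n + 1)) ++ (block (gWord (n + 2)) ++
      block (gWord (n + 3)))) := by
  simp only [← factor_etaWord_block]
  rw [show 48 = 12 + (12 + (12 + 12)) from rfl, factor_add, factor_add, factor_add]
  rfl

/-- Every factor of `etaWord` of length at most 37 lies in the image of four letters. -/
theorem exists_factor_etaWord (i : ℕ) {m : ℕ} (hm : m ≤ 37) : ∃ a b c d : Fin 4,
    Adj a b ∧ Adj b c ∧ Adj c d ∧ factor etaWord i m =
      ((block a ++ (block b ++ (block c ++ block d))).drop (i % 12)).take m := by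
  refine ⟨_, _, _, _, adj_gWord (i / 12), adj_gWord (i / 12 + 1), adj_gWord (i / 12 + 2), ?_⟩
  rw [← factor_etaWord_blocks, ← factor_eq_take_drop _ (by omega), Nat.div_add_mod]

theorem square_block_short : ∀ a b, Adj a b → ∀ c, Adj b c → ∀ d, Adj c d → ∀ r : Fin 12,
    ∀ n : Fin 19, n ≠ 0 →
    (((block a ++ (block b ++ (block c ++ block d))).drop r).take (2 * n)).take n =
      (((block a ++ (block b ++ (block c ++ block d))).drop r).take (2 * n)).drop n →
    ((block a ++ (block b ++ (block c ++ block d))).drop r).take (2 * n) ∈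
      [[0, 0], [1, 1], [1, 0, 1, 0]] := by
  decide +kernel

/-- The factors of length 19 of `etaWord` that start at the position `r` of a block. -/
def windows (r : ℕ) : List (List (Fin 2)) :=
  [[0, 1, 2], [0, 2, 0], [0, 2, 3], [1, 2, 0], [1, 2, 3], [2, 0, 1], [2, 0, 2], [2, 3, 0],
    [3, 0, 1], [3, 0, 2]].map fun l => ((apply block l).drop r).take 19

theorem windows_disjoint : ∀ r r' : Fin 12, ∀ l ∈ windows r, l ∈ windows r' → r = r' := by
  decide +kernel

theorem factor_etaWord_mem_windows (i : ℕ) : factor etaWord i 19 ∈ windows (i % 12) := by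
  have h : ∀ a b, Adj a b → ∀ c, Adj b c → [a, b, c] ∈ ([[0, 1, 2], [0, 2, 0], [0, 2, 3],
      [1, 2, 0], [1, 2, 3], [2, 0, 1], [2, 0, 2], [2, 3, 0], [3, 0, 1], [3, 0, 2]] :
        List (List (Fin 4))) := by
    decide
  refine List.mem_map.2 ⟨_, h _ _ (adj_gWord (i / 12)) _ (adj_gWord (i / 12 + 1)), ?_⟩
  have h1 : apply block [gWord (i / 12), gWord (i / 12 + 1), gWord (i / 12 + 1 + 1)] =
      factor etaWord (12 * (i / 12)) 36 := by
    rw [show 36 = 12 + (12 + 12) from rfl, factor_add, factor_add, factor_etaWord_block]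
    simp only [← mul_add_one, factor_etaWord_block]
    simp [apply]
  rw [h1, ← factor_eq_take_drop _ (by omega), Nat.div_add_mod]

/-- A factor of length 19 of `etaWord` determines its position modulo 12. -/
theorem mod_eq_of_factor_etaWord_eq {i j : ℕ} (h : factor etaWord i 19 = factor etaWord j 19) :
    i % 12 = j % 12 := by
  have hi := factor_etaWord_mem_windows i
  have hj := factor_etaWord_mem_windows j
  rw [← h] at hj
  exact congrArg Fin.val (windows_disjoint ⟨i % 12, Nat.mod_lt _ (by norm_num)⟩
    ⟨j % 12, Nat.mod_lt _ (by norm_num)⟩ _ hi hj)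

theorem not_square_etaWord_of_dvd (i : ℕ) {q : ℕ} (hq : 2 ≤ q) :
    ¬ ∀ j < 12 * q, etaWord (i + j) = etaWord (i + 12 * q + j) := by
  intro h
  have hinj : ∀ a b : Fin 4, (∀ r : Fin 12, blockLetter a r = blockLetter b r) → a = b := by
    decide
  -- A partly covered end block still yields its outer bit: once the inner bit is known, two
  -- positions separate the remaining letters.
  have hleft : ∀ a b : Fin 4, sndBit a = sndBit b → blockLetter a 7 = blockLetter b 7 →
      blockLetter a 9 = blockLetter b 9 → fstBit a = fstBit b := by
    decide
  have hright : ∀ a b : Fin 4, fstBit a = fstBit b → blockLetter a 4 = blockLetter b 4 →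
      blockLetter a 6 = blockLetter b 6 → sndBit a = sndBit b := by
    decide
  obtain ⟨n, r, hr, rfl⟩ : ∃ n r, r < 12 ∧ i = 12 * n + r :=
    ⟨i / 12, i % 12, Nat.mod_lt _ (by norm_num), (Nat.div_add_mod _ _).symm⟩
  have hletter : ∀ k l, l < 12 → 12 * n + r ≤ 12 * k + l → 12 * k + l < 12 * (n + q) + r →
      blockLetter (gWord k) l = blockLetter (gWord (k + q)) l := by
    intro k l hl h1 h2
    have := h (12 * k + l - (12 * n + r)) (by omega)
    rwa [show 12 * n + r + (12 * k + l - (12 * n + r)) = 12 * k + l by omega,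
      show 12 * n + r + 12 * q + (12 * k + l - (12 * n + r)) = 12 * (k + q) + l by omega,
      etaWord_eq _ hl, etaWord_eq _ hl] at this
  have hfull : ∀ k, n < k → k < n + q → gWord k = gWord (k + q) := fun k h1 h2 =>
    hinj _ _ fun l => hletter k l l.2 (by omega) (by omega)
  have hmid : ∀ k, n < k → k ≤ n + q → thueMorse k = thueMorse (k + q) := by
    intro k h1 h2
    rcases h2.lt_or_eq with h2 | rfl
    · rw [thueMorse, hfull k h1 h2, thueMorse]
    · have := hfull (n + q - 1) (by omega) (by omega)
      rw [show n + q = n + q - 1 + 1 by omega, thueMorse_succ, this, ← thueMorse_succ]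
      congr 1
      omega
  -- `hmid` gives `q` equalities; an overlap needs one more. If `r ≤ 7`, positions 7 and 9 of block
  -- `n` are covered and extend it to the left; otherwise positions 4 and 6 of block `n + q` extend
  -- it to the right.
  rcases le_or_gt r 7 with h7 | h7
  · refine thueMorse_overlapFree q n (by omega) fun j hj => ?_
    rcases Nat.eq_zero_or_pos j with rfl | hj0
    · have h1 := hmid (n + 1) (by omega) (by omega)
      rw [thueMorse_succ, show n + 1 + q = n + q + 1 by ring, thueMorse_succ] at h1
      exact hleft _ _ h1 (hletter n 7 (by omega) (by omega) (by omega))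
        (hletter n 9 (by omega) (by omega) (by omega))
    · exact hmid (n + j) (by omega) (by omega)
  · refine thueMorse_overlapFree q (n + 1) (by omega) fun j hj => ?_
    rcases hj.lt_or_eq with hj | rfl
    · exact hmid (n + 1 + j) (by omega) (by omega)
    · have h1 := hmid (n + j) (by omega) le_rfl
      rw [show n + 1 + j = n + j + 1 by ring, show n + j + 1 + j = n + j + j + 1 by ring,
        thueMorse_succ, thueMorse_succ]
      exact hright _ _ h1 (hletter (n + j) 4 (by omega) (by omega) (by omega))
        (hletter (n + j) 6 (by omega) (by omega) (by omega))

theorem squares_etaWord : squares etaWord = {[0, 0], [1, 1], [1, 0, 1, 0]} := by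
  ext u
  constructor
  · rintro ⟨⟨x, hx, rfl⟩, i, n, hu⟩
    have hn : n = x.length + x.length := by
      simpa [length_factor] using (congrArg List.length hu).symm
    subst hn
    have hpos : 0 < x.length := List.length_pos_iff.2 hx
    rcases lt_or_ge x.length 19 with hlt | hge
    · obtain ⟨a, b, c, d, hab, hbc, hcd, hf⟩ := exists_factor_etaWord i
        (m := 2 * x.length) (by omega)
      rw [← two_mul, hf] at hu
      have := square_block_short a b hab c hbc d hcd ⟨i % 12, Nat.mod_lt _ (by norm_num)⟩
        ⟨x.length, hlt⟩ (by simpa [Fin.ext_iff] using hx)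
      simp only [← hu, List.take_left, List.drop_left] at this
      simpa using this
    · rw [factor_add] at hu
      obtain ⟨h1, h2⟩ := List.append_inj hu (length_factor _ _ _).symm
      have h3 := (factor_eq_factor_iff _ _ _ _).1 (h1.symm.trans h2)
      have h4 := mod_eq_of_factor_etaWord_eq ((factor_eq_factor_iff _ _ _ _).2
        fun j (hj : j < 19) => h3 j (by omega))
      obtain ⟨q, hq⟩ : 12 ∣ x.length := by omega
      -- Here `q ≥ 2`, as the period is at least 19.
      rw [hq] at h3
      exact (not_square_etaWord_of_dvd i (by omega) h3).elim
  · have h : ∀ i m, i % 12 + m ≤ 12 → factor etaWord i m =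
        ((block (gWord (i / 12))).drop (i % 12)).take m := by
      intro i m him
      rw [← factor_etaWord_block, ← factor_eq_take_drop _ him, Nat.div_add_mod]
    rintro (rfl | rfl | rfl)
    · exact ⟨⟨[0], by simp, rfl⟩, 0, 2, by rw [h _ _ (by norm_num)]; rfl⟩
    · exact ⟨⟨[1], by simp, rfl⟩, 2, 2, by rw [h _ _ (by norm_num)]; rfl⟩
    · exact ⟨⟨[1, 0], by simp, rfl⟩, 13, 4, by rw [h _ _ (by norm_num)]; rfl⟩

end Squares

end Words

theorem theorem5 :
    Words.squares (Words.image Words.eta Words.vtm) = {[0, 0], [1, 1], [1, 0, 1, 0]} ∧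
    Words.IsAutomatic 2 (Words.image Words.eta Words.vtm) ∧
    IsLeast (Words.stateCounts 2 (Words.image Words.eta Words.vtm)) 27 ∧
    IsLeast (Words.generatorWeights 2 (Words.image Words.eta Words.vtm)) 54 :=
  ⟨Words.squares_etaWord, ⟨27, _, _, _, Words.isGeneratedBy_h27⟩,
    Words.isLeast_stateCounts_etaWord, Words.isLeast_generatorWeights_etaWord⟩
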